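/- All graphs are finite and simple. A \emph{Helly EPT representation} of a graph $G$ consists of a finite tree $T$ (the host tree) and a family $(P_v)_{v\in V(G)}$ of subpaths of $T$ such that two distinct vertices $v,w$ of $G$ are adjacent if and only if $E(P_v)\cap E(P_w)\neq\emptyset$, and such that the family $(E(P_v))_{v\in V(G)}$ has the Helly property: every non-empty subfamily of pairwise intersecting members has non-empty total intersection. A graph is \emph{Helly EPT} if it has such a representation, and it belongs to the class Helly $[h,2,2]$ if it has such a representation whose host tree has maximum degree $h$. A \emph{clique} is an inclusion-maximal set of pairwise adjacent vertices. A clique $C$ of a connected graph $H$ is a \emph{separator} of $H$ if $H-C$ is disconnected (the graph without vertices is not disconnected); an \emph{atom} is a connected non-empty graph without separators. A \emph{clique decomposition tree} of a connected graph $H$ is obtained as follows: if $H$ is an atom, it is a single leaf carrying $H$; otherwise choose a separator $C$ of $H$, which is carried by the root, and attach to the root, for each connected component $K$ of $H-C$, a clique decomposition tree of the induced subgraph $H[C\cup V(K)]$. Fix one clique decomposition tree for each connected component of $G$ (a single one if $G$ is connected); the \emph{atoms of $G$} are the graphs carried by their leaves. \textbf{Theorem.} Let $G$ be a Helly EPT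 graph and let $h\ge 3$ be an integer. Then, for every choice of the clique decomposition trees, $G$ belongs to Helly $[h,2,2]$ if and only if every atom of $G$ has at most $h$ cliques. -/

import Mathlib

namespace HellyEPT

universe u

/-- A family of sets has the Helly property if every non-empty, pairwise intersecting subfamily
has non-empty total intersection. -/
def HellyProperty {ι α : Type*} (S : ι → Set α) : Prop :=
  ∀ I : Set ι, I.Nonempty → I.Pairwise (fun i j => (S i ∩ S j).Nonempty) →
    (⋂ i ∈ I, S i).Nonempty

/-- An edge-intersection representation of `G` by a family of subpaths, one for each vertex of `G`,
of the host graph `T` (which is required to be a tree wherever this is used). -/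
structure PathRep {V : Type*} {W : Type*} (G : SimpleGraph V) (T : SimpleGraph W) where
  src : V → W
  tgt : V → W
  path : ∀ v, T.Walk (src v) (tgt v)
  isPath : ∀ v, (path v).IsPath
  adj_iff : ∀ v w, G.Adj v w ↔ v ≠ w ∧ ((path v).edgeSet ∩ (path w).edgeSet).Nonempty

/-- `G` admits an EPT representation on a finite host tree whose family of edge sets of paths has
the Helly property. -/
def IsHellyEPT {V : Type*} (G : SimpleGraph V) : Prop :=
  ∃ (W : Type) (_ : Fintype W) (T : SimpleGraph W) (_ : T.IsTree) (R : PathRep G T),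
    HellyProperty (fun v => (R.path v).edgeSet)

/-- The class Helly `[h,2,2]`: as `IsHellyEPT`, on a finite host tree of maximum degree `h`. -/
def IsHellyDeg {V : Type*} (G : SimpleGraph V) (h : ℕ) : Prop :=
  ∃ (W : Type) (_ : Fintype W) (T : SimpleGraph W) (_ : DecidableRel T.Adj) (_ : T.IsTree)
    (_ : T.maxDegree = h) (R : PathRep G T), HellyProperty (fun v => (R.path v).edgeSet)

/-- `C` is a clique, i.e. an inclusion-maximal complete set, of the induced subgraph `G[A]`. -/
def IsMaxClique {V : Type*} (G : SimpleGraph V) (A C : Set V) : Prop :=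
  Maximal (fun S : Set V => S ⊆ A ∧ G.IsClique S) C

/-- The clique `C` of the connected graph `G[A]` is a separator: `G[A \ C]` is not connected.
(`Preconnected` counts the graph without vertices as connected, so a complete graph has no
separator.) -/
def IsSeparator {V : Type*} (G : SimpleGraph V) (A C : Set V) : Prop :=
  (G.induce A).Connected ∧ IsMaxClique G A C ∧ ¬ (G.induce (A \ C)).Preconnected

/-- `G[A]` is an atom: a connected graph without separators. -/
def IsAtomSet {V : Type*} (G : SimpleGraph V) (A : Set V) : Prop :=
  (G.induce A).Connected ∧ ∀ C : Set V, ¬ IsSeparator G A C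

/-- The clique decomposition trees of `G[A]`. A leaf carries an atom. An internal node carries a
separator `C` of `G[A]`, and has one child for each connected component `K` of `G[A \ C]`: a clique
decomposition tree of `G[C ∪ K]`. -/
inductive CliqueDecompTree {V : Type u} (G : SimpleGraph V) : Set V → Type u
  | leaf (A : Set V) (hA : IsAtomSet G A) : CliqueDecompTree G A
  | node (A C : Set V) (hC : IsSeparator G A C)
      (child : ∀ K : (G.induce (A \ C)).ConnectedComponent,
        CliqueDecompTree G (C ∪ Subtype.val '' K.supp)) : CliqueDecompTree G A

/-- The (vertex sets of the) atoms at the leaves of a clique decomposition tree. -/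
def CliqueDecompTree.atoms {V : Type u} {G : SimpleGraph V} {A : Set V} :
    CliqueDecompTree G A → Set (Set V)
  | .leaf A _ => {A}
  | .node _ _ _ child => ⋃ K, (child K).atoms

/-- Every finite connected graph has a clique decomposition tree. -/
theorem nonempty_cliqueDecompTree {V : Type u} [Finite V] (G : SimpleGraph V) (A : Set V)
    (hA : (G.induce A).Connected) : Nonempty (CliqueDecompTree G A) := by
  induction hn : A.ncard using Nat.strong_induction_on generalizing A with
  | _ n ih =>
  subst hn
  by_cases hat : ∀ C : Set V, ¬ IsSeparator G A C
  · exact ⟨.leaf A ⟨hA, hat⟩⟩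
  push Not at hat
  obtain ⟨C, hC⟩ := hat
  have hCA : C ⊆ A := hC.2.1.prop.1
  have hcl : G.IsClique C := hC.2.1.prop.2
  obtain ⟨c₀, hc₀⟩ : C.Nonempty := by
    by_contra hne
    rw [Set.not_nonempty_iff_eq_empty] at hne
    obtain ⟨x⟩ := hA.nonempty
    have := hC.2.1.2 (y := {x.1}) ⟨by simp, by simp⟩ (by simp [hne]) rfl
    simp [hne] at this
  have key : ∀ K : (G.induce (A \ C)).ConnectedComponent,
      Nonempty (CliqueDecompTree G (C ∪ Subtype.val '' K.supp)) := by
    intro K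
    have hsub : C ∪ Subtype.val '' K.supp ⊆ A := by
      rintro x (hx | ⟨y, _, rfl⟩)
      · exact hCA hx
      · exact y.2.1
    refine ih _ ?_ _ ?_ rfl
    · apply Set.ncard_lt_ncard _ (Set.toFinite _)
      refine ⟨hsub, fun hAs => hC.2.2 ?_⟩
      have hall : ∀ y : ↥(A \ C), (G.induce (A \ C)).connectedComponentMk y = K := by
        intro y
        rcases hAs y.2.1 with hy | ⟨z, hz, hzy⟩
        · exact absurd hy y.2.2
        · rw [← Subtype.ext hzy]; exact hz
      intro y z
      exact SimpleGraph.ConnectedComponent.exact ((hall y).trans (hall z).symm)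
    · have hCreach : ∀ x (hx : x ∈ C), (G.induce (C ∪ Subtype.val '' K.supp)).Reachable
          ⟨x, Or.inl hx⟩ ⟨c₀, Or.inl hc₀⟩ := by
        intro x hx
        by_cases hxc : x = c₀
        · subst hxc; exact .refl _
        · exact SimpleGraph.Adj.reachable (hcl hx hc₀ hxc)
      have hK : ∀ (x y : A) (_ : (G.induce A).Walk x y) (_ : y.1 ∈ C)
          (hx : x.1 ∈ C ∪ Subtype.val '' K.supp),
          (G.induce (C ∪ Subtype.val '' K.supp)).Reachable ⟨x.1, hx⟩ ⟨c₀, Or.inl hc₀⟩ := by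
        intro x y p
        induction p with
        | nil => intro hy _; exact hCreach _ hy
        | @cons a b c hab p ihp =>
          intro hy hx
          by_cases haC : a.1 ∈ C
          · exact hCreach _ haC
          have hb : b.1 ∈ C ∪ Subtype.val '' K.supp := by
            by_cases hbC : b.1 ∈ C
            · exact Or.inl hbC
            rcases hx with hx | ⟨z, hz, hza⟩
            · exact absurd hx haC
            refine Or.inr ⟨⟨b.1, b.2, hbC⟩, ?_, rfl⟩
            have hadj : (G.induce (A \ C)).Adj z ⟨b.1, b.2, hbC⟩ := by
              change G.Adj z.1 b.1
              rw [hza]; exact hab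
            exact (SimpleGraph.ConnectedComponent.sound hadj.reachable.symm).trans hz
          exact (SimpleGraph.Adj.reachable (show (G.induce _).Adj ⟨a.1, hx⟩ ⟨b.1, hb⟩ from hab)).trans
            (ihp hy hb)
      have hr : ∀ x, (G.induce (C ∪ Subtype.val '' K.supp)).Reachable x ⟨c₀, Or.inl hc₀⟩ := by
        rintro ⟨x, hx⟩
        obtain ⟨p⟩ := hA.preconnected ⟨x, hsub hx⟩ ⟨c₀, hCA hc₀⟩
        exact hK _ _ p hc₀ hx
      have : Nonempty ↥(C ∪ Subtype.val '' K.supp) := ⟨⟨c₀, Or.inl hc₀⟩⟩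
      exact ⟨fun x y => (hr x).trans (hr y).symm⟩
  exact ⟨.node A C hC fun K => (key K).some⟩

end HellyEPT

/-!
Let `f` be an edge of the host tree and extend the vertices of an atom whose paths use `f` to a
clique `C`. The atom minus `C` is connected and none of its paths uses `f`, so these paths all lie
on one side of `f`, and so do the common edges of all cliques other than `C`. Orient every host edge
towards that side. Some vertex `c` is the head of all its edges. A clique whose common edge is or
lies behind an edge `cx` is the exceptional clique of `cx`, so there are at most `deg c` cliques.

Conversely, let `c` be a host vertex of degree greater than `h`. If all links of `c` are connected,
no separator disconnects the paths passing through `c`. They survive together in an atom, which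
then has at least `deg c` cliques, one for each edge at `c`. Hence, if all atoms have at most `h`
cliques, some link is disconnected, and its components tell how to split `c` into two adjacent
vertices of smaller degree without changing the graph or losing the Helly property.
-/

namespace HellyEPT

open SimpleGraph

/-! ### Deleting an edge of a tree -/

section Tree

variable {W : Type*} {T : SimpleGraph W}

theorem reachable_deleteEdges_of_mem_support {a b x y : W} {e : Sym2 W} (p : T.Walk a b)
    (he : e ∉ p.edges) (hx : x ∈ p.support) (hy : y ∈ p.support) :
    (T.deleteEdges {e}).Reachable x y := by
  classical
  have reachable_of_mem : ∀ z ∈ p.support, (T.deleteEdges {e}).Reachable a z := fun z hz =>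
    ⟨(p.takeUntil z hz).toDeleteEdge e fun h => he (p.edges_takeUntil_subset_edges hz h)⟩
  exact (reachable_of_mem x hx).symm.trans (reachable_of_mem y hy)

theorem mem_edges_iff_not_reachable_deleteEdges (hT : T.IsAcyclic) {a b : W} {p : T.Walk a b}
    (hp : p.IsPath) {e : Sym2 W} : e ∈ p.edges ↔ ¬ (T.deleteEdges {e}).Reachable a b := by
  classical
  refine ⟨?_, p.mem_edges_of_not_reachable_deleteEdges⟩
  rintro he ⟨q⟩
  have hpq : p = q.bypass.mapLe (deleteEdges_le {e}) :=
    congrArg Subtype.val ((hT.subsingleton_path a b).elim ⟨p, hp⟩ ⟨_, q.bypass_isPath.mapLe _⟩)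
  rw [hpq, Walk.edges_mapLe_eq_edges] at he
  simpa using q.bypass.edges_subset_edgeSet he

theorem reachable_deleteEdges_left_or_right (hT : T.Connected) (x y z : W) :
    (T.deleteEdges {s(x, y)}).Reachable x z ∨ (T.deleteEdges {s(x, y)}).Reachable y z := by
  classical
  obtain ⟨p, hp⟩ := hT.exists_isPath z x
  by_cases he : s(x, y) ∈ p.edges
  · have hy : y ∈ p.support := p.snd_mem_support_of_mem_edges he
    have hx : x ∉ (p.takeUntil y hy).support :=
      p.endpoint_notMem_support_takeUntil hp hy (p.adj_of_mem_edges he).ne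
    refine Or.inr (reachable_deleteEdges_of_mem_support (p.takeUntil y hy) (fun h => hx ?_)
      (Walk.end_mem_support _) (Walk.start_mem_support _))
    exact Walk.fst_mem_support_of_mem_edges _ h
  · exact Or.inl (reachable_deleteEdges_of_mem_support p he p.end_mem_support p.start_mem_support)

theorem exists_adj_mem_not_reachable_deleteEdges (hT : T.IsTree) (c : W) {e : Sym2 W}
    (he : e ∈ T.edgeSet) :
    ∃ x, T.Adj c x ∧ ∃ b ∈ e, ¬ (T.deleteEdges {s(c, x)}).Reachable c b := by
  obtain ⟨b, hb, hbc⟩ : ∃ b ∈ e, b ≠ c := by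
    induction e with | _ p q =>
    by_cases hp : p = c
    · exact ⟨q, by simp, hp ▸ he.ne'⟩
    · exact ⟨p, by simp, hp⟩
  obtain ⟨p, hp⟩ := hT.connected.exists_isPath c b
  cases p with
  | nil => exact absurd rfl hbc
  | cons hcx p =>
    exact ⟨_, hcx, b, hb, (mem_edges_iff_not_reachable_deleteEdges hT.isAcyclic hp).1 (by simp)⟩

/-- Otherwise every vertex is the end not chosen of some edge, and different vertices are so for
different edges, but a tree has more vertices than edges. -/
theorem exists_forall_adj_head_eq [Finite W] (hT : T.IsTree) {head : Sym2 W → W}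
    (hhead : ∀ e ∈ T.edgeSet, head e ∈ e) : ∃ c, ∀ x, T.Adj c x → head s(c, x) = c := by
  by_contra! hcon
  choose x hx hne using hcon
  have head_eq (c : W) : head s(c, x c) = x c :=
    (Sym2.mem_iff.1 (hhead _ (hx c))).resolve_left (hne c)
  have injective : Function.Injective fun c => (⟨s(c, x c), hx c⟩ : T.edgeSet) := by
    intro c d hcd
    have heq : s(c, x c) = s(d, x d) := congrArg Subtype.val hcd
    have hxx : x c = x d := by rw [← head_eq c, heq, head_eq d]
    rw [hxx] at heq
    exact Sym2.congr_left.1 heq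
  have hle : Nat.card W ≤ Nat.card T.edgeSet := Nat.card_le_card_of_injective _ injective
  have hcard := (isTree_iff_connected_and_card.1 hT).2
  omega

end Tree

/-! ### Cliques and representations -/

section Cliques

variable {V : Type*} {G : SimpleGraph V} {A C D S : Set V}

theorem exists_isMaxClique_superset (hSA : S ⊆ A) (hS : G.IsClique S) :
    ∃ C, S ⊆ C ∧ IsMaxClique G A C := by
  refine zorn_subset_nonempty {S | S ⊆ A ∧ G.IsClique S} (fun F hF hchain _ => ?_) S ⟨hSA, hS⟩
  exact ⟨⋃₀ F, ⟨Set.sUnion_subset fun S hS => (hF hS).1,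
    (Set.pairwise_sUnion hchain.directedOn).2 fun S hS => (hF hS).2⟩,
    fun _ => Set.subset_sUnion_of_mem⟩

theorem IsMaxClique.nonempty (hC : IsMaxClique G A C) (hA : A.Nonempty) : C.Nonempty := by
  obtain ⟨a, ha⟩ := hA
  by_contra hne
  rw [Set.not_nonempty_iff_eq_empty] at hne
  simpa [hne] using hC.2 (y := {a}) ⟨by simpa using ha, by simp⟩ (by simp [hne]) rfl

theorem IsMaxClique.exists_mem_notMem (hC : IsMaxClique G A C) (hD : IsMaxClique G A D)
    (hne : D ≠ C) : ∃ v ∈ D, v ∉ C :=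
  Set.not_subset.1 fun h => hne (hD.eq_of_subset hC.prop h)

end Cliques

namespace PathRep

variable {V W : Type*} {G : SimpleGraph V} {T : SimpleGraph W} (R : PathRep G T)

theorem adj_of_mem_edges {v w : V} {e : Sym2 W} (hne : v ≠ w) (hv : e ∈ (R.path v).edges)
    (hw : e ∈ (R.path w).edges) : G.Adj v w :=
  (R.adj_iff v w).2 ⟨hne, e, hv, hw⟩

theorem isClique_of_forall_mem_edges {S : Set V} {e : Sym2 W}
    (h : ∀ v ∈ S, e ∈ (R.path v).edges) : G.IsClique S :=
  fun v hv w hw hne => R.adj_of_mem_edges hne (h v hv) (h w hw)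

theorem eq_sep_mem_edges_of_isMaxClique {A C : Set V} (hC : IsMaxClique G A C) {e : Sym2 W}
    (he : ∀ v ∈ C, e ∈ (R.path v).edges) : C = {v ∈ A | e ∈ (R.path v).edges} :=
  hC.eq_of_subset ⟨Set.sep_subset _ _, R.isClique_of_forall_mem_edges fun _ hv => hv.2⟩
    fun v hv => ⟨hC.prop.1 hv, he v hv⟩

variable {R}

theorem exists_common_edge (hR : HellyProperty fun v => (R.path v).edgeSet) {S : Set V}
    (hS : G.IsClique S) (hne : S.Nonempty) : ∃ e, ∀ v ∈ S, e ∈ (R.path v).edges := by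
  obtain ⟨e, he⟩ := hR S hne fun v hv w hw hvw => ((R.adj_iff v w).1 (hS hv hw hvw)).2
  exact ⟨e, Set.mem_iInter₂.1 he⟩

end PathRep

/-! ### Atoms have few cliques -/

theorem CliqueDecompTree.isAtomSet_of_mem_atoms {V : Type*} {G : SimpleGraph V} {A B : Set V}
    (t : CliqueDecompTree G A) (hB : B ∈ t.atoms) : IsAtomSet G B := by
  induction t with
  | leaf A hA =>
    rw [atoms, Set.mem_singleton_iff] at hB
    exact hB ▸ hA
  | node A C hC child ih =>
    rw [atoms, Set.mem_iUnion] at hB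
    obtain ⟨K, hK⟩ := hB
    exact ih K hK

namespace PathRep

variable {V W : Type*} {G : SimpleGraph V} {T : SimpleGraph W}

theorem reachable_src_of_reachable (R : PathRep G T) {B : Set V} {f : Sym2 W}
    (hB : ∀ v ∈ B, f ∉ (R.path v).edges) {v w : B} (h : (G.induce B).Reachable v w) :
    (T.deleteEdges {f}).Reachable (R.src v) (R.src w) := by
  obtain ⟨p⟩ := h
  induction p with
  | nil => exact .refl _
  | @cons u v w huv _ ih =>
    obtain ⟨-, e, hu, hv⟩ := (R.adj_iff u v).1 huv
    obtain ⟨x, hx⟩ : ∃ x, x ∈ e := ⟨_, e.out_fst_mem⟩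
    have hux := reachable_deleteEdges_of_mem_support (R.path u) (hB u u.2)
      (Walk.start_mem_support _) (Walk.mem_support_of_mem_edges hu hx)
    have hxv := reachable_deleteEdges_of_mem_support (R.path v) (hB v v.2)
      (Walk.mem_support_of_mem_edges hv hx) (Walk.start_mem_support _)
    exact (hux.trans hxv).trans ih

theorem exists_mem_forall_reachable_src (R : PathRep G T) (hT : T.Connected) {B : Set V}
    (hB : (G.induce B).Preconnected) {f : Sym2 W} (hf : ∀ v ∈ B, f ∉ (R.path v).edges) :
    ∃ r ∈ f, ∀ v ∈ B, (T.deleteEdges {f}).Reachable r (R.src v) := by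
  induction f with | _ p q =>
  rcases B.eq_empty_or_nonempty with rfl | ⟨w, hw⟩
  · exact ⟨p, by simp, by simp⟩
  have src_src (v : V) (hv : v ∈ B) : (T.deleteEdges {s(p, q)}).Reachable (R.src w) (R.src v) :=
    R.reachable_src_of_reachable hf (hB ⟨w, hw⟩ ⟨v, hv⟩)
  rcases reachable_deleteEdges_left_or_right hT p q (R.src w) with h | h
  · exact ⟨p, by simp, fun v hv => h.trans (src_src v hv)⟩
  · exact ⟨q, by simp, fun v hv => h.trans (src_src v hv)⟩

theorem exists_side_of_isAtomSet (R : PathRep G T) (hT : T.Connected) {A : Set V}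
    (hA : IsAtomSet G A) (f : Sym2 W) :
    ∃ r ∈ f, ∃ C, ∀ D, IsMaxClique G A D → D ≠ C → ∀ e, (∀ v ∈ D, e ∈ (R.path v).edges) →
      ∀ x ∈ e, (T.deleteEdges {f}).Reachable r x := by
  obtain ⟨C, hfC, hC⟩ := exists_isMaxClique_superset (Set.sep_subset A _)
    (R.isClique_of_forall_mem_edges (S := {v ∈ A | f ∈ (R.path v).edges}) fun _ hv => hv.2)
  have hf : ∀ v ∈ A \ C, f ∉ (R.path v).edges := fun v hv h => hv.2 (hfC ⟨hv.1, h⟩)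
  have preconnected : (G.induce (A \ C)).Preconnected := by
    by_contra h
    exact hA.2 C ⟨hA.1, hC, h⟩
  obtain ⟨r, hr, hrv⟩ := R.exists_mem_forall_reachable_src hT preconnected hf
  refine ⟨r, hr, C, fun D hD hne e he x hx => ?_⟩
  obtain ⟨v, hvD, hvC⟩ := hC.exists_mem_notMem hD hne
  have hv : v ∈ A \ C := ⟨hD.prop.1 hvD, hvC⟩
  exact (hrv v hv).trans (reachable_deleteEdges_of_mem_support _ (hf v hv)
    (Walk.start_mem_support _) (Walk.mem_support_of_mem_edges (he v hvD) hx))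

theorem ncard_isMaxClique_le_maxDegree [Fintype W] [DecidableRel T.Adj] {R : PathRep G T}
    (hT : T.IsTree) (hR : HellyProperty fun v => (R.path v).edgeSet) {A : Set V}
    (hA : IsAtomSet G A) : {C | IsMaxClique G A C}.ncard ≤ T.maxDegree := by
  obtain ⟨⟨a, ha⟩⟩ := hA.1.nonempty
  choose head hhead exc hexc using R.exists_side_of_isAtomSet hT.connected hA
  obtain ⟨c, hc⟩ := exists_forall_adj_head_eq hT fun e _ => hhead e
  have exists_adj (D : {D // IsMaxClique G A D}) : ∃ x, T.Adj c x ∧ D = exc s(c, x) := by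
    obtain ⟨v, hv⟩ := D.2.nonempty ⟨a, ha⟩
    obtain ⟨e, he⟩ := exists_common_edge hR D.2.prop.2 ⟨v, hv⟩
    obtain ⟨x, hx, b, hb, hcb⟩ := exists_adj_mem_not_reachable_deleteEdges hT c
      ((R.path v).edges_subset_edgeSet (he v hv))
    refine ⟨x, hx, not_not.1 fun hne => hcb ?_⟩
    simpa only [hc x hx] using hexc s(c, x) D D.2 hne e he b hb
  choose x hx hD using exists_adj
  have injective : Function.Injective fun D => (⟨x D, hx D⟩ : T.neighborSet c) :=
    fun D D' h => Subtype.ext (by rw [hD D, hD D', show x D = x D' from congrArg Subtype.val h])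
  calc {C | IsMaxClique G A C}.ncard
      ≤ Nat.card (T.neighborSet c) := Nat.card_le_card_of_injective _ injective
    _ = T.degree c := by rw [Nat.card_eq_fintype_card, card_neighborSet_eq_degree]
    _ ≤ T.maxDegree := T.degree_le_maxDegree c

end PathRep

/-! ### Host vertices with connected links -/

namespace PathRep

section Link

variable {V W : Type*} {G : SimpleGraph V} {T : SimpleGraph W} (R : PathRep G T) (c x : W)

/-- The vertices of `G` whose paths have `c` as an inner vertex. -/
def through : Set V :=
  {v | ∃ y z, y ≠ z ∧ s(c, y) ∈ (R.path v).edges ∧ s(c, z) ∈ (R.path v).edges}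

/-- The link of `c` away from its neighbour `x`: the graph on the other neighbours of `c` in which
two of them are adjacent if some path that avoids the edge `cx` passes through both. If it is
disconnected, `c` can be split along its components. -/
def link : SimpleGraph ↥(T.neighborSet c \ {x}) where
  Adj y z := y ≠ z ∧ ∃ v, s(c, x) ∉ (R.path v).edges ∧
    s(c, y.1) ∈ (R.path v).edges ∧ s(c, z.1) ∈ (R.path v).edges
  symm := ⟨fun _ _ ⟨h, v, hx, hy, hz⟩ => ⟨h.symm, v, hx, hz, hy⟩⟩
  loopless := ⟨fun _ h => h.1 rfl⟩

variable {R c x}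

theorem exists_mem_edges_of_mem_through {v : V} (hv : v ∈ R.through c) (x : W) :
    ∃ y : ↥(T.neighborSet c \ {x}), s(c, y.1) ∈ (R.path v).edges := by
  obtain ⟨y, z, hyz, hy, hz⟩ := hv
  by_cases hyx : y = x
  · exact ⟨⟨z, (R.path v).adj_of_mem_edges hz, fun hzx => hyz (hyx.trans hzx.symm)⟩, hz⟩
  · exact ⟨⟨y, (R.path v).adj_of_mem_edges hy, hyx⟩, hy⟩

theorem mem_support_of_mem_through {v : V} (hv : v ∈ R.through c) : c ∈ (R.path v).support := by
  obtain ⟨_, _, _, hy, _⟩ := hv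
  exact (R.path v).fst_mem_support_of_mem_edges hy

theorem reachable_induce_of_mem_through (hlink : (R.link c x).Preconnected) {B : Set V}
    (hB : ∀ v ∈ R.through c, s(c, x) ∉ (R.path v).edges → v ∈ B) {v w : B}
    (hv : v.1 ∈ R.through c) (hw : w.1 ∈ R.through c) : (G.induce B).Reachable v w := by
  have reachable_of_mem_edges {v w : B} {e : Sym2 W} (hev : e ∈ (R.path v).edges)
      (hew : e ∈ (R.path w).edges) : (G.induce B).Reachable v w := by
    by_cases hvw : v = w
    · exact hvw ▸ .refl _
    · exact Adj.reachable (R.adj_of_mem_edges (fun h => hvw (Subtype.ext h)) hev hew)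
  obtain ⟨y, hy⟩ := exists_mem_edges_of_mem_through hv x
  obtain ⟨z, hz⟩ := exists_mem_edges_of_mem_through hw x
  obtain ⟨p⟩ := hlink y z
  induction p generalizing v with
  | nil => exact reachable_of_mem_edges hy hz
  | @cons a b _ hab _ ih =>
    obtain ⟨hne, u, hux, hua, hub⟩ := hab
    have hu : u ∈ R.through c := ⟨a, b, fun h => hne (Subtype.ext h), hua, hub⟩
    exact (reachable_of_mem_edges (w := ⟨u, hB u hu hux⟩) hy hua).trans (ih hu hub hz)

theorem exists_mem_through_of_link (hdeg : 3 ≤ (T.neighborSet c).ncard)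
    (hlink : (R.link c x).Preconnected) {y : W} (hy : T.Adj c y) (hyx : y ≠ x) :
    ∃ v ∈ R.through c, s(c, y) ∈ (R.path v).edges ∧ s(c, x) ∉ (R.path v).edges := by
  obtain ⟨z, hz, hzyx⟩ : ∃ z ∈ T.neighborSet c, z ∉ ({y, x} : Set W) :=
    Set.exists_mem_notMem_of_ncard_lt_ncard <|
      (Set.ncard_insert_le y {x}).trans_lt (by rwa [Set.ncard_singleton])
  simp only [Set.mem_insert_iff, Set.mem_singleton_iff, not_or] at hzyx
  obtain ⟨p⟩ := hlink ⟨y, hy, hyx⟩ ⟨z, hz, hzyx.2⟩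
  cases p with
  | nil => exact absurd rfl hzyx.1
  | @cons _ u _ hyu _ =>
    obtain ⟨hne, v, hvx, hvy, hvu⟩ := hyu
    exact ⟨v, ⟨y, u, fun h => hne (Subtype.ext h), hvy, hvu⟩, hvy, hvx⟩

theorem through_nonempty_of_link (hdeg : 3 ≤ (T.neighborSet c).ncard)
    (hlink : (R.link c x).Preconnected) : (R.through c).Nonempty := by
  obtain ⟨y, hy, hyx⟩ := Set.exists_mem_notMem_of_ncard_lt_ncard
    (show ({x} : Set W).ncard < (T.neighborSet c).ncard by rw [Set.ncard_singleton]; omega)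
  obtain ⟨v, hv, -⟩ := exists_mem_through_of_link hdeg hlink hy hyx
  exact ⟨v, hv⟩

end Link

section Atoms

variable {V W : Type*} {G : SimpleGraph V} {T : SimpleGraph W} {R : PathRep G T} {c : W}

theorem exists_adj_forall_mem_edges (hT : T.IsTree)
    (hR : HellyProperty fun v => (R.path v).edgeSet) (c : W) {S : Set V} (hS : G.IsClique S)
    (hne : S.Nonempty) :
    ∃ x, T.Adj c x ∧ ∀ v ∈ S, c ∈ (R.path v).support → s(c, x) ∈ (R.path v).edges := by
  obtain ⟨e, he⟩ := exists_common_edge hR hS hne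
  obtain ⟨w, hw⟩ := hne
  obtain ⟨x, hx, b, hb, hcb⟩ := exists_adj_mem_not_reachable_deleteEdges hT c
    ((R.path w).edges_subset_edgeSet (he w hw))
  refine ⟨x, hx, fun v hv hc => not_not.1 fun hvx => hcb ?_⟩
  exact reachable_deleteEdges_of_mem_support _ hvx hc
    (Walk.mem_support_of_mem_edges (he v hv) hb)

/-- A separator only contains paths through `c` that leave `c` along a common edge `cx`, so
removing it does not disconnect the others. -/
theorem exists_mem_atoms_through_subset (hT : T.IsTree)
    (hR : HellyProperty fun v => (R.path v).edgeSet)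
    (hlink : ∀ x, T.Adj c x → (R.link c x).Preconnected) {A : Set V} (t : CliqueDecompTree G A)
    (hA : R.through c ⊆ A) : ∃ B ∈ t.atoms, R.through c ⊆ B := by
  induction t with
  | leaf A _ => exact ⟨A, rfl, hA⟩
  | node A C hC child ih =>
    obtain ⟨⟨a, ha⟩⟩ := hC.1.nonempty
    obtain ⟨x, hx, hxC⟩ := exists_adj_forall_mem_edges hT hR c hC.2.1.prop.2
      (hC.2.1.nonempty ⟨a, ha⟩)
    obtain ⟨K, hK⟩ : ∃ K : (G.induce (A \ C)).ConnectedComponent,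
        R.through c ⊆ C ∪ Subtype.val '' K.supp := by
      by_cases hsub : R.through c ⊆ C
      · obtain ⟨y, -⟩ := not_forall.1 hC.2.2
        exact ⟨connectedComponentMk _ y, fun v hv => Or.inl (hsub hv)⟩
      · obtain ⟨v, hv, hvC⟩ := Set.not_subset.1 hsub
        refine ⟨connectedComponentMk _ ⟨v, hA hv, hvC⟩, fun w hw => ?_⟩
        by_cases hwC : w ∈ C
        · exact Or.inl hwC
        refine Or.inr ⟨⟨w, hA hw, hwC⟩, ConnectedComponent.sound ?_, rfl⟩
        exact reachable_induce_of_mem_through (B := A \ C) (hlink x hx)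
          (fun u hu hux => ⟨hA hu, fun huC => hux (hxC u huC (mem_support_of_mem_through hu))⟩)
          hw hv
    obtain ⟨B, hB, hcB⟩ := ih K hK
    exact ⟨B, by rw [CliqueDecompTree.atoms]; exact Set.mem_iUnion.2 ⟨K, hB⟩, hcB⟩

theorem finite_setOf_isMaxClique [Finite W] (hR : HellyProperty fun v => (R.path v).edgeSet)
    {A : Set V} (hA : A.Nonempty) : {C | IsMaxClique G A C}.Finite := by
  have exists_edge (C : {C // IsMaxClique G A C}) : ∃ e, ∀ v ∈ C.1, e ∈ (R.path v).edges :=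
    exists_common_edge hR C.2.prop.2 (C.2.nonempty hA)
  choose e he using exists_edge
  have injective : Function.Injective e := fun C D hCD => Subtype.ext <| by
    rw [R.eq_sep_mem_edges_of_isMaxClique C.2 (he C),
      R.eq_sep_mem_edges_of_isMaxClique D.2 (he D), hCD]
  exact Set.finite_coe_iff.1 (Finite.of_injective e injective)

/-- The vertices whose paths pass through `c` along `cx` form a clique for every neighbour `x` of
`c`, and no clique of `G[A]` contains two of these. -/
theorem ncard_neighborSet_le_ncard_isMaxClique [Finite W] (hT : T.IsTree)
    (hR : HellyProperty fun v => (R.path v).edgeSet) (hdeg : 3 ≤ (T.neighborSet c).ncard)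
    (hlink : ∀ x, T.Adj c x → (R.link c x).Preconnected) {A : Set V} (hA : R.through c ⊆ A)
    (hne : A.Nonempty) : (T.neighborSet c).ncard ≤ {C | IsMaxClique G A C}.ncard := by
  have exists_clique (x : W) :
      ∃ C, {v ∈ R.through c | s(c, x) ∈ (R.path v).edges} ⊆ C ∧ IsMaxClique G A C :=
    exists_isMaxClique_superset (fun v hv => hA hv.1)
      (R.isClique_of_forall_mem_edges fun v hv => hv.2)
  choose C hsub hC using exists_clique
  refine Set.ncard_le_ncard_of_injOn C (fun x _ => hC x) (fun x hx y hy hxy => ?_)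
    (finite_setOf_isMaxClique hR hne)
  obtain ⟨b, hb, hbC⟩ := exists_adj_forall_mem_edges hT hR c (hC x).prop.2 ((hC x).nonempty hne)
  have eq_b (z : W) (hz : T.Adj c z) (hzx : C z = C x) : z = b := by
    by_contra hzb
    obtain ⟨v, hv, hvz, hvb⟩ := exists_mem_through_of_link hdeg (hlink b hb) hz hzb
    exact hvb (hbC v (hzx ▸ hsub z ⟨hv, hvz⟩) (mem_support_of_mem_through hv))
  exact (eq_b x hx rfl).trans (eq_b y hy hxy.symm).symm

theorem exists_mem_atoms_ncard_neighborSet_le [Finite W] (hT : T.IsTree)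
    (hR : HellyProperty fun v => (R.path v).edgeSet) (hdeg : 3 ≤ (T.neighborSet c).ncard)
    (hlink : ∀ x, T.Adj c x → (R.link c x).Preconnected)
    (D : ∀ K : G.ConnectedComponent, CliqueDecompTree G K.supp) :
    ∃ K, ∃ A ∈ (D K).atoms, (T.neighborSet c).ncard ≤ {C | IsMaxClique G A C}.ncard := by
  obtain ⟨x, hx⟩ : (T.neighborSet c).Nonempty := Set.nonempty_of_ncard_ne_zero (by omega)
  obtain ⟨a, ha⟩ := through_nonempty_of_link hdeg (hlink x hx)
  have hsub : R.through c ⊆ (G.connectedComponentMk a).supp := fun v hv =>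
    ConnectedComponent.sound <|
      (reachable_induce_of_mem_through (B := Set.univ) (v := ⟨v, trivial⟩) (w := ⟨a, trivial⟩)
        (hlink x hx) (fun _ _ _ => trivial) hv ha).map (Embedding.induce _).toHom
  obtain ⟨A, hA, hcA⟩ := exists_mem_atoms_through_subset hT hR hlink (D _) hsub
  exact ⟨_, A, hA, ncard_neighborSet_le_ncard_isMaxClique hT hR hdeg hlink hcA ⟨a, hcA ha⟩⟩

end Atoms

end PathRep

/-! ### Splitting a vertex of the host tree -/

section Split

variable {W : Type*}

/-- The edge of `split T c N` between the two vertices into which `c` is split. -/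
def newEdge (c : W) : Sym2 (Option W) := s(none, some c)

/-- The contraction of the new edge of `split T c N`. -/
def merge (c : W) (x : Option W) : W := x.getD c

open Classical in
/-- The vertex over `a` at which the edge `ab` is attached when `c` is split: the edges from `c` to
`N` go to the copy `none` of `c`, all others stay at `some c`. -/
noncomputable def liftEnd (c : W) (N : Set W) (a b : W) : Option W :=
  if a = c ∧ b ∈ N then none else some a

/-- The edge of `split T c N` over a given edge. -/
noncomputable def liftEdge (c : W) (N : Set W) : Sym2 W → Sym2 (Option W) :=
  Sym2.lift ⟨fun a b => s(liftEnd c N a b, liftEnd c N b a), fun _ _ => Sym2.eq_swap⟩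

/-- The graph obtained from `T` by splitting `c` into two adjacent vertices `some c` and `none`, the
neighbours of `c` in `N` being attached to `none` and its other neighbours to `some c`. -/
noncomputable def split (T : SimpleGraph W) (c : W) (N : Set W) : SimpleGraph (Option W) :=
  fromEdgeSet (insert (newEdge c) (liftEdge c N '' T.edgeSet))

variable {T : SimpleGraph W} {c : W} {N : Set W}

@[simp] theorem merge_none : merge c none = c := rfl

@[simp] theorem merge_some (a : W) : merge c (some a) = a := rfl

theorem liftEnd_of_ne {a b : W} (ha : a ≠ c) : liftEnd c N a b = some a :=
  if_neg fun h => ha h.1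

theorem liftEnd_eq_none {a b : W} : liftEnd c N a b = none ↔ a = c ∧ b ∈ N := by
  simp [liftEnd]

theorem liftEnd_of_notMem {a b : W} (hb : b ∉ N) : liftEnd c N a b = some a :=
  if_neg fun h => hb h.2

@[simp] theorem merge_liftEnd (a b : W) : merge c (liftEnd c N a b) = a := by
  unfold liftEnd
  split_ifs with h
  · exact h.1.symm
  · rfl

@[simp] theorem map_merge_liftEdge (e : Sym2 W) : (liftEdge c N e).map (merge c) = e := by
  induction e with | _ a b =>
  simp [liftEdge]

theorem liftEdge_injective : Function.Injective (liftEdge c N) :=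
  Function.LeftInverse.injective map_merge_liftEdge

theorem not_isDiag_liftEdge {e : Sym2 W} (he : e ∈ T.edgeSet) : ¬ (liftEdge c N e).IsDiag := by
  intro h
  refine T.not_isDiag_of_mem_edgeSet he ?_
  rw [← map_merge_liftEdge (c := c) (N := N) e]
  exact h.map

theorem liftEdge_ne_newEdge {e : Sym2 W} (he : e ∈ T.edgeSet) : liftEdge c N e ≠ newEdge c := by
  intro h
  refine T.not_isDiag_of_mem_edgeSet he ?_
  rw [← map_merge_liftEdge (c := c) (N := N) e, h]
  simp [newEdge]

theorem edgeSet_split :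
    (split T c N).edgeSet = insert (newEdge c) (liftEdge c N '' T.edgeSet) := by
  rw [split, edgeSet_fromEdgeSet, sdiff_eq_left, Set.disjoint_left]
  rintro _ (rfl | ⟨e, he, rfl⟩)
  · simp [newEdge]
  · exact not_isDiag_liftEdge he

theorem split_adj {x y : Option W} : (split T c N).Adj x y ↔ s(x, y) = newEdge c ∨
    ∃ a b, T.Adj a b ∧ x = liftEnd c N a b ∧ y = liftEnd c N b a := by
  rw [← mem_edgeSet, edgeSet_split, Set.mem_insert_iff]
  refine or_congr_right ⟨?_, ?_⟩
  · rintro ⟨e, he, hexy⟩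
    induction e with | _ a b =>
    rcases Sym2.eq_iff.1 hexy with ⟨hx, hy⟩ | ⟨hy, hx⟩
    · exact ⟨a, b, he, hx.symm, hy.symm⟩
    · exact ⟨b, a, he.symm, hx.symm, hy.symm⟩
  · rintro ⟨a, b, hab, rfl, rfl⟩
    exact ⟨s(a, b), hab, rfl⟩

theorem split_adj_none_some_self : (split T c N).Adj none (some c) := split_adj.2 (Or.inl rfl)

theorem split_adj_liftEnd {a b : W} (h : T.Adj a b) :
    (split T c N).Adj (liftEnd c N a b) (liftEnd c N b a) :=
  split_adj.2 (Or.inr ⟨a, b, h, rfl, rfl⟩)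

theorem reachable_of_merge_eq {H : SimpleGraph (Option W)} (hH : H.Adj none (some c))
    {x y : Option W} (h : merge c x = merge c y) : H.Reachable x y := by
  rcases x with _ | a <;> rcases y with _ | b
  · exact .refl _
  · obtain rfl : c = b := h
    exact hH.reachable
  · obtain rfl : a = c := h
    exact hH.reachable.symm
  · obtain rfl : a = b := h
    exact .refl _

theorem reachable_of_reachable_merge {T : SimpleGraph W} {H : SimpleGraph (Option W)}
    (hH : H.Adj none (some c))
    (hlift : ∀ a b, T.Adj a b → H.Adj (liftEnd c N a b) (liftEnd c N b a)) {x y : Option W}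
    (h : T.Reachable (merge c x) (merge c y)) : H.Reachable x y := by
  obtain ⟨p⟩ := h
  generalize ha : merge c x = a, hb : merge c y = b at p
  induction p generalizing x with
  | nil => exact reachable_of_merge_eq hH (ha.trans hb.symm)
  | @cons a b _ hab _ ih =>
    have hx : H.Reachable x (liftEnd c N a b) := reachable_of_merge_eq hH (by simp [ha])
    exact (hx.trans (hlift a b hab).reachable).trans (ih (by simp) hb)

theorem reachable_split_deleteEdges_liftEdge {e : Sym2 W} (he : e ∈ T.edgeSet)
    {x y : Option W} : ((split T c N).deleteEdges {liftEdge c N e}).Reachable x y ↔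
      (T.deleteEdges {e}).Reachable (merge c x) (merge c y) := by
  constructor
  · rintro ⟨p⟩
    induction p with
    | nil => exact .refl _
    | @cons x y _ hxy p ih =>
      refine Reachable.trans ?_ ih
      obtain ⟨hadj, hne⟩ := deleteEdges_adj.1 hxy
      rcases split_adj.1 hadj with hnew | ⟨a, b, hab, rfl, rfl⟩
      · rcases Sym2.eq_iff.1 hnew with ⟨rfl, rfl⟩ | ⟨rfl, rfl⟩ <;> exact .refl _
      · rw [merge_liftEnd, merge_liftEnd]
        exact Adj.reachable (deleteEdges_adj.2 ⟨hab, fun h => hne (congrArg (liftEdge c N) h)⟩)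
  · refine reachable_of_reachable_merge (N := N)
      (deleteEdges_adj.2 ⟨split_adj_none_some_self, (liftEdge_ne_newEdge he).symm⟩)
      fun a b hab => ?_
    obtain ⟨hadj, hne⟩ := deleteEdges_adj.1 hab
    exact deleteEdges_adj.2 ⟨split_adj_liftEnd hadj, fun h => hne (liftEdge_injective h)⟩

theorem isTree_split [Finite W] (hT : T.IsTree) : (split T c N).IsTree := by
  have connected : (split T c N).Connected :=
    ⟨fun x y => reachable_of_reachable_merge split_adj_none_some_self
      (fun _ _ => split_adj_liftEnd) (hT.connected.preconnected (merge c x) (merge c y))⟩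
  refine isTree_iff_connected_and_card.2 ⟨connected, le_antisymm ?_
    connected.card_vert_le_card_edgeSet_add_one⟩
  have card_edgeSet : (split T c N).edgeSet.ncard ≤ T.edgeSet.ncard + 1 := by
    rw [edgeSet_split]
    exact (Set.ncard_insert_le _ _).trans (by gcongr; exact Set.ncard_image_le)
  rw [Finite.card_option, ← (isTree_iff_connected_and_card.1 hT).2]
  simpa only [Nat.card_coe_set_eq, add_le_add_iff_right] using card_edgeSet

theorem neighborSet_split_none :
    (split T c N).neighborSet none = insert (some c) (some '' (T.neighborSet c ∩ N)) := by
  ext y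
  rw [mem_neighborSet, split_adj]
  refine or_congr (by simp [newEdge]) ⟨?_, ?_⟩
  · rintro ⟨a, b, hab, ha, rfl⟩
    obtain ⟨rfl, hb⟩ := liftEnd_eq_none.1 ha.symm
    exact ⟨b, ⟨hab, hb⟩, (liftEnd_of_ne hab.ne').symm⟩
  · rintro ⟨b, ⟨hcb, hb⟩, rfl⟩
    exact ⟨c, b, hcb, (liftEnd_eq_none.2 ⟨rfl, hb⟩).symm, (liftEnd_of_ne hcb.ne').symm⟩

theorem neighborSet_split_some_self :
    (split T c N).neighborSet (some c) = insert none (some '' (T.neighborSet c \ N)) := by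
  ext y
  rw [mem_neighborSet, split_adj]
  refine or_congr (by simp [newEdge, Sym2.eq_swap (a := some c)]) ⟨?_, ?_⟩
  · rintro ⟨a, b, hab, ha, rfl⟩
    obtain rfl : c = a := by simpa using congrArg (merge c) ha
    have hb : b ∉ N := fun hb => by simp [liftEnd_eq_none.2 ⟨rfl, hb⟩] at ha
    exact ⟨b, ⟨hab, hb⟩, (liftEnd_of_ne hab.ne').symm⟩
  · rintro ⟨b, ⟨hcb, hb⟩, rfl⟩
    exact ⟨c, b, hcb, (liftEnd_of_notMem hb).symm, (liftEnd_of_ne hcb.ne').symm⟩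

theorem neighborSet_split_some_subset {w : W} (hw : w ≠ c) :
    (split T c N).neighborSet (some w) ⊆ (liftEnd c N · w) '' T.neighborSet w := by
  intro y hy
  rcases split_adj.1 hy with hnew | ⟨a, b, hab, ha, rfl⟩
  · simp [newEdge, hw] at hnew
  · obtain rfl : w = a := by simpa using congrArg (merge c) ha
    exact ⟨b, hab, rfl⟩

theorem ncard_neighborSet_split_none [Finite W] :
    ((split T c N).neighborSet none).ncard = (T.neighborSet c ∩ N).ncard + 1 := by
  rw [neighborSet_split_none, Set.ncard_insert_of_notMem,
    Set.ncard_image_of_injective _ (Option.some_injective W)]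
  rintro ⟨b, ⟨hcb, -⟩, h⟩
  exact hcb.ne' (Option.some_injective W h)

theorem ncard_neighborSet_split_some_self [Finite W] :
    ((split T c N).neighborSet (some c)).ncard = (T.neighborSet c \ N).ncard + 1 := by
  rw [neighborSet_split_some_self, Set.ncard_insert_of_notMem (by simp),
    Set.ncard_image_of_injective _ (Option.some_injective W)]

theorem ncard_neighborSet_split_some_le [Finite W] {w : W} (hw : w ≠ c) :
    ((split T c N).neighborSet (some w)).ncard ≤ (T.neighborSet w).ncard :=
  (Set.ncard_le_ncard (neighborSet_split_some_subset hw)).trans Set.ncard_image_le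

/-- The total amount by which the degrees exceed three, which bounds the number of splittings. -/
noncomputable def excess [Fintype W] (T : SimpleGraph W) : ℕ :=
  ∑ w, ((T.neighborSet w).ncard - 3)

theorem excess_split_lt [Fintype W] (h₁ : 2 ≤ (T.neighborSet c ∩ N).ncard)
    (h₂ : 2 ≤ (T.neighborSet c \ N).ncard) : excess (split T c N) < excess T := by
  classical
  have sum_le : ∑ w ∈ Finset.univ.erase c, (((split T c N).neighborSet (some w)).ncard - 3) ≤
      ∑ w ∈ Finset.univ.erase c, ((T.neighborSet w).ncard - 3) :=
    Finset.sum_le_sum fun w hw => Nat.sub_le_sub_right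
      (ncard_neighborSet_split_some_le (Finset.ne_of_mem_erase hw)) 3
  have hncard := Set.ncard_inter_add_ncard_sdiff_eq_ncard (T.neighborSet c) N
  rw [excess, excess, Fintype.sum_option, ← Finset.add_sum_erase _ _ (Finset.mem_univ c),
    ← Finset.add_sum_erase _ (fun w => (T.neighborSet w).ncard - 3) (Finset.mem_univ c),
    ncard_neighborSet_split_none, ncard_neighborSet_split_some_self]
  omega

end Split

/-! ### Representations on the split host tree -/

section LiftWalk

variable {W : Type*} {T : SimpleGraph W} {c : W} {N : Set W} {a b : W}

theorem exists_section_of_walk (p : T.Walk a b)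
    (hp : (∀ y, s(c, y) ∈ p.edges → y ∈ N) ∨ ∀ y, s(c, y) ∈ p.edges → y ∉ N) :
    ∃ g : W → Option W, (∀ y, merge c (g y) = y) ∧
      ∀ y z, s(y, z) ∈ p.edges → liftEnd c N y z = g y := by
  classical
  rcases hp with hp | hp
  · refine ⟨fun y => if y = c then none else some y, fun y => ?_, fun y z hyz => ?_⟩
    · beta_reduce
      split_ifs with hy
      exacts [hy.symm, rfl]
    · beta_reduce
      split_ifs with hy
      · subst hy
        exact liftEnd_eq_none.2 ⟨rfl, hp z hyz⟩
      · exact liftEnd_of_ne hy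
  · exact ⟨some, merge_some, fun y z hyz => if_neg fun ⟨hy, hz⟩ => hp z (hy ▸ hyz) hz⟩

theorem exists_reachable_lift_of_walk (p : T.Walk a b)
    (hp : (∀ y, s(c, y) ∈ p.edges → y ∈ N) ∨ ∀ y, s(c, y) ∈ p.edges → y ∉ N) :
    ∃ x y, merge c x = a ∧ merge c y = b ∧
      ((split T c N).deleteEdges {newEdge c}).Reachable x y := by
  obtain ⟨g, hg, hpg⟩ := exists_section_of_walk p hp
  refine ⟨g a, g b, hg a, hg b, ?_⟩
  clear hp
  induction p with
  | nil => exact .refl _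
  | @cons u v _ huv p ih =>
    refine Reachable.trans (Adj.reachable ?_) (ih fun y z h => hpg y z (List.mem_cons_of_mem _ h))
    rw [← hpg u v (by simp), ← hpg v u (by simp [Sym2.eq_swap (a := v)])]
    exact deleteEdges_adj.2 ⟨split_adj_liftEnd huv, liftEdge_ne_newEdge (e := s(u, v)) huv⟩

end LiftWalk

theorem HellyProperty.of_lift {ι α β : Type*} {S : ι → Set α} {S' : ι → Set β}
    (hS : HellyProperty S) (hdown : ∀ i j, (S' i ∩ S' j).Nonempty → (S i ∩ S j).Nonempty)
    (hup : ∀ i, ∀ a ∈ S i, ∃ b, ∀ j, a ∈ S j → b ∈ S' j) : HellyProperty S' := by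
  intro I hI hpair
  obtain ⟨a, ha⟩ := hS I hI fun i hi j hj hij => hdown i j (hpair hi hj hij)
  rw [Set.mem_iInter₂] at ha
  obtain ⟨i, hi⟩ := hI
  obtain ⟨b, hb⟩ := hup i a (ha i hi)
  exact ⟨b, Set.mem_iInter₂.2 fun j hj => hb j (ha j hj)⟩

namespace PathRep

variable {V W : Type*} {G : SimpleGraph V} {T : SimpleGraph W} {R : PathRep G T} {c x : W}
  {N : Set W}

/-- Splitting `c` along `N` does not force apart the edges at `c` of any path avoiding `cx`. The
other paths may use the new edge, as they share `cx` anyway. -/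
def IsSplitting (R : PathRep G T) (c x : W) (N : Set W) : Prop :=
  ∀ v, s(c, x) ∉ (R.path v).edges →
    (∀ y, s(c, y) ∈ (R.path v).edges → y ∈ N) ∨ ∀ y, s(c, y) ∈ (R.path v).edges → y ∉ N

theorem IsSplitting.exists_ends (hN : R.IsSplitting c x N) (v : V) :
    ∃ a b, merge c a = R.src v ∧ merge c b = R.tgt v ∧ (s(c, x) ∉ (R.path v).edges →
      ((split T c N).deleteEdges {newEdge c}).Reachable a b) := by
  by_cases hv : s(c, x) ∈ (R.path v).edges
  · exact ⟨some (R.src v), some (R.tgt v), rfl, rfl, fun h => absurd hv h⟩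
  · obtain ⟨a, b, ha, hb, hab⟩ := exists_reachable_lift_of_walk (R.path v) (hN v hv)
    exact ⟨a, b, ha, hb, fun _ => hab⟩

theorem exists_pathRep_split [Finite W] (hT : T.IsTree)
    (hR : HellyProperty fun v => (R.path v).edgeSet) (hN : R.IsSplitting c x N) :
    ∃ R' : PathRep G (split T c N), HellyProperty fun v => (R'.path v).edgeSet := by
  have hT' : (split T c N).IsTree := isTree_split hT
  choose src tgt hsrc htgt hlift using hN.exists_ends
  choose path isPath using fun v => hT'.connected.exists_isPath (src v) (tgt v)
  have newEdge_mem (v : V) (h : newEdge c ∈ (path v).edges) : s(c, x) ∈ (R.path v).edges := by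
    by_contra hv
    exact (mem_edges_iff_not_reachable_deleteEdges hT'.isAcyclic (isPath v)).1 h (hlift v hv)
  have liftEdge_mem (v : V) {e : Sym2 W} (he : e ∈ T.edgeSet) :
      liftEdge c N e ∈ (path v).edges ↔ e ∈ (R.path v).edges := by
    rw [mem_edges_iff_not_reachable_deleteEdges hT'.isAcyclic (isPath v),
      reachable_split_deleteEdges_liftEdge he, hsrc, htgt,
      mem_edges_iff_not_reachable_deleteEdges hT.isAcyclic (R.isPath v)]
  have hdown (v w : V) (h : ((path v).edgeSet ∩ (path w).edgeSet).Nonempty) :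
      ((R.path v).edgeSet ∩ (R.path w).edgeSet).Nonempty := by
    obtain ⟨d, hv, hw⟩ := h
    have hd := (path v).edges_subset_edgeSet hv
    rw [edgeSet_split] at hd
    obtain rfl | ⟨e, he, rfl⟩ := hd
    · exact ⟨_, newEdge_mem v hv, newEdge_mem w hw⟩
    · exact ⟨e, (liftEdge_mem v he).1 hv, (liftEdge_mem w he).1 hw⟩
  have hup (v : V) (e : Sym2 W) (he : e ∈ (R.path v).edgeSet) :
      ∃ d, ∀ w, e ∈ (R.path w).edgeSet → d ∈ (path w).edgeSet :=
    ⟨liftEdge c N e, fun w => (liftEdge_mem w ((R.path v).edges_subset_edgeSet he)).2⟩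
  refine ⟨⟨src, tgt, path, isPath, fun v w => ?_⟩, hR.of_lift hdown hup⟩
  refine (R.adj_iff v w).trans (and_congr_right fun _ => ⟨?_, hdown v w⟩)
  rintro ⟨e, hv, hw⟩
  obtain ⟨d, hd⟩ := hup v e hv
  exact ⟨d, hd v hv, hd w hw⟩

theorem isSplitting_empty : R.IsSplitting c x ∅ := fun _ _ => Or.inr fun _ _ => id

theorem IsSplitting.compl_insert (hN : R.IsSplitting c x N) : R.IsSplitting c x (insert x N)ᶜ := by
  intro v hv
  rcases hN v hv with h | h
  · exact Or.inr fun y hy hyN => hyN (Or.inr (h y hy))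
  · refine Or.inl fun y hy => ?_
    rintro (rfl | hyN)
    exacts [hv hy, h y hy hyN]

theorem isSplitting_supp (K : (R.link c x).ConnectedComponent) :
    R.IsSplitting c x (Subtype.val '' K.supp) := by
  intro v hv
  by_contra! hcon
  obtain ⟨⟨y, hy, hyK⟩, z, hz, u, huK, rfl⟩ := hcon
  have hcy : y ∈ T.neighborSet c \ {x} :=
    ⟨(R.path v).adj_of_mem_edges hy, fun hyx => hv (hyx ▸ hy)⟩
  have huy : u ≠ ⟨y, hcy⟩ := fun h => hyK ⟨u, huK, congrArg Subtype.val h⟩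
  have hadj : (R.link c x).Adj u ⟨y, hcy⟩ := ⟨huy, v, hv, hz, hy⟩
  exact hyK ⟨_, K.mem_supp_of_adj_mem_supp huK hadj, rfl⟩

theorem exists_isSplitting_of_link [Finite W] (hdeg : 4 ≤ (T.neighborSet c).ncard)
    (hx : T.Adj c x) (hlink : ¬ (R.link c x).Preconnected) : ∃ N, R.IsSplitting c x N ∧
      2 ≤ (T.neighborSet c ∩ N).ncard ∧ 2 ≤ (T.neighborSet c \ N).ncard := by
  simp only [Preconnected, not_forall] at hlink
  obtain ⟨y, z, hyz⟩ := hlink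
  let K := (R.link c x).connectedComponentMk y
  let N : Set W := Subtype.val '' K.supp
  have hN : R.IsSplitting c x N := isSplitting_supp K
  have hyN : y.1 ∈ N := ⟨y, rfl, rfl⟩
  have hzN : z.1 ∉ N := by
    rw [Subtype.val_injective.mem_set_image]
    exact fun h => hyz (ConnectedComponent.exact h).symm
  have hxN : x ∉ N := by
    rintro ⟨u, -, hux⟩
    exact u.2.2 hux
  have two_le {P : Set W} {a b : W} (ha : a ∈ P) (hb : b ∈ P) (hab : a ≠ b) : 2 ≤ P.ncard :=
    (Set.one_lt_ncard).2 ⟨a, ha, b, hb, hab⟩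
  by_cases hcard : 2 ≤ (T.neighborSet c ∩ N).ncard
  · exact ⟨N, hN, hcard, two_le ⟨hx, hxN⟩ ⟨z.2.1, hzN⟩ fun h => z.2.2 h.symm⟩
  · refine ⟨(insert x N)ᶜ, hN.compl_insert, ?_, ?_⟩
    · have h₁ := Set.ncard_insert_le x (T.neighborSet c ∩ N)
      have h₂ := Set.ncard_inter_add_ncard_sdiff_eq_ncard (T.neighborSet c) (insert x N)
      rw [Set.inter_insert_of_mem (show x ∈ T.neighborSet c from hx)] at h₂
      rw [← Set.sdiff_eq]
      omega
    · rw [Set.sdiff_compl]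
      exact two_le ⟨hx, Set.mem_insert x N⟩ ⟨y.2.1, Or.inr hyN⟩ fun h => y.2.2 h.symm

end PathRep

/-! ### Host trees of prescribed maximum degree -/

section HostTree

variable {V : Type*} {G : SimpleGraph V} {W : Type} {T : SimpleGraph W} {h : ℕ}

theorem ncard_neighborSet_eq_degree (T : SimpleGraph W) [Fintype W] [DecidableRel T.Adj] (w : W) :
    (T.neighborSet w).ncard = T.degree w := by
  rw [← Nat.card_coe_set_eq, Nat.card_eq_fintype_card, card_neighborSet_eq_degree]

/-- Splitting a vertex along the empty set attaches a leaf to it. -/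
theorem isHellyDeg_of_ncard_neighborSet_le [Finite W] (hT : T.IsTree) {R : PathRep G T}
    (hR : HellyProperty fun v => (R.path v).edgeSet)
    (hdeg : ∀ w, (T.neighborSet w).ncard ≤ h) : IsHellyDeg G h := by
  classical
  obtain ⟨c⟩ := hT.connected.nonempty
  induction hk : h - (T.neighborSet c).ncard generalizing W with
  | zero =>
    cases nonempty_fintype W
    refine ⟨W, inferInstance, T, inferInstance, hT, le_antisymm ?_ ?_, R, hR⟩
    · exact T.maxDegree_le_of_forall_degree_le h fun w => ncard_neighborSet_eq_degree T w ▸ hdeg w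
    · exact (Nat.sub_eq_zero_iff_le.1 hk).trans
        (ncard_neighborSet_eq_degree T c ▸ T.degree_le_maxDegree c)
  | succ k ih =>
    obtain ⟨R', hR'⟩ := PathRep.exists_pathRep_split hT hR
      (PathRep.isSplitting_empty (c := c) (x := c))
    have hc : ((split T c ∅).neighborSet (some c)).ncard = (T.neighborSet c).ncard + 1 := by
      rw [ncard_neighborSet_split_some_self, Set.sdiff_empty]
    refine ih (isTree_split hT) hR' (fun w => ?_) (some c) (by omega)
    rcases w with _ | w
    · rw [ncard_neighborSet_split_none, Set.inter_empty, Set.ncard_empty]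
      omega
    obtain rfl | hw := eq_or_ne w c
    · omega
    · exact (ncard_neighborSet_split_some_le hw).trans (hdeg w)

theorem isHellyDeg_of_ncard_isMaxClique_le [Finite W] (hh : 3 ≤ h)
    (D : ∀ K : G.ConnectedComponent, CliqueDecompTree G K.supp)
    (hD : ∀ K, ∀ A ∈ (D K).atoms, {C | IsMaxClique G A C}.ncard ≤ h) (hT : T.IsTree)
    {R : PathRep G T} (hR : HellyProperty fun v => (R.path v).edgeSet) : IsHellyDeg G h := by
  cases nonempty_fintype W
  induction hn : excess T using Nat.strong_induction_on generalizing W with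
  | _ n ih =>
  by_cases hdeg : ∀ w, (T.neighborSet w).ncard ≤ h
  · exact isHellyDeg_of_ncard_neighborSet_le hT hR hdeg
  push Not at hdeg
  obtain ⟨c, hc⟩ := hdeg
  by_cases hlink : ∀ x, T.Adj c x → (R.link c x).Preconnected
  · obtain ⟨K, A, hA, hle⟩ :=
      PathRep.exists_mem_atoms_ncard_neighborSet_le hT hR (by omega) hlink D
    exact absurd (hle.trans (hD K A hA)) hc.not_ge
  · push Not at hlink
    obtain ⟨x, hx, hlink⟩ := hlink
    obtain ⟨N, hN, h₁, h₂⟩ := PathRep.exists_isSplitting_of_link (by omega) hx hlink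
    obtain ⟨R', hR'⟩ := PathRep.exists_pathRep_split hT hR hN
    exact ih _ (hn ▸ excess_split_lt h₁ h₂) (isTree_split hT) hR' inferInstance rfl

end HostTree

end HellyEPT

theorem theorem4_general {V : Type*} (G : SimpleGraph V) (hG : HellyEPT.IsHellyEPT G)
    (h : ℕ) (hh : 3 ≤ h)
    (D : ∀ K : G.ConnectedComponent, HellyEPT.CliqueDecompTree G K.supp) :
    HellyEPT.IsHellyDeg G h ↔
      ∀ K : G.ConnectedComponent, ∀ A ∈ (D K).atoms,
        {C : Set V | HellyEPT.IsMaxClique G A C}.ncard ≤ h := by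
  constructor
  · rintro ⟨W, _, T, _, hT, rfl, R, hR⟩ K A hA
    exact HellyEPT.PathRep.ncard_isMaxClique_le_maxDegree hT hR ((D K).isAtomSet_of_mem_atoms hA)
  · intro hD
    obtain ⟨W, _, T, hT, R, hR⟩ := hG
    exact HellyEPT.isHellyDeg_of_ncard_isMaxClique_le hh D hD hT hR

/-- `D` is a choice of one clique decomposition tree for each connected component of `G`. -/
theorem theorem4 {V : Type*} [Finite V] (G : SimpleGraph V) (hG : HellyEPT.IsHellyEPT G)
    (h : ℕ) (hh : 3 ≤ h)
    (D : ∀ K : G.ConnectedComponent, HellyEPT.CliqueDecompTree G K.supp) :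
    HellyEPT.IsHellyDeg G h ↔
      ∀ K : G.ConnectedComponent, ∀ A ∈ (D K).atoms,
        {C : Set V | HellyEPT.IsMaxClique G A C}.ncard ≤ h :=
  theorem4_general G hG h hh D
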